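/- Let $d\ge 2$, $n\ge 1$, let $\Omega\subset\mathbb R^d$ be open and let $Q=[0,1]^d$ be the periodicity cell. Let $a^{(1)}=(a^{(1)}_{ijpq})\in (L^\infty_\#(Q))^{n\times d\times n\times d}$ be symmetric, $a^{(1)}_{ijpq}=a^{(1)}_{pqij}$, and non-negative, $a^{(1)}_{ijpq}\zeta_{ij}\zeta_{pq}\ge 0$ for all $\zeta\in\mathbb R^{n\times d}$, and let $(a^{(1)}(y))^{1/2}$ be its pointwise non-negative square root. Let $H^{-1}_\#(Q)$ be the dual of the periodic Sobolev space $H^1_\#(Q)$, and put $$V=\{v\in (H^1_\#(Q))^n:\ a^{(1)}\nabla_y v=0\},\qquad W=\{\psi\in (L^2_\#(Q))^{n\times d}:\ \mathrm{div}_y((a^{(1)})^{1/2}\psi)=0 \text{ in } (H^{-1}_\#(Q))^n\}.$$ Let $V^\perp$ be the orthogonal complement of $V$ in $(H^1_\#(Q))^n$ with respect to any fixed inner product whose norm is equivalent to the standard one, and let $P_W$ be the $L^2$-orthogonal projector of $(L^2_\#(Q))^{n\times d}$ on $W$. Assume that there is a constant $C>0$ such that every $v\in (H^1_\#(Q))^n$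 admits some $v_1\in V$ with $\|v-v_1\|_{(H^1_\#(Q))^n}\le C\|a^{(1)}\nabla_y v\|_{L^2(Q)}$. For $u\in L^2(\Omega;V)$ and $\xi\in L^2(\Omega;W)$ write $u\in U$, $Tu=\xi$ if $$\int_\Omega\int_Q \xi\cdot\Psi\,dy\,dx=-\int_\Omega\int_Q u\cdot \mathrm{div}_x\big((a^{(1)}(y))^{1/2}\Psi(x,y)\big)\,dy\,dx$$ for all $\Psi\in C^\infty(\Omega;W)$ which, together with their first derivatives in $x$, are in $L^2(\Omega;(L^2_\#(Q))^{n\times d})$. Let $\phi_0\in C_0^\infty(\Omega;V)$. Then $\phi_0\in U$, $T\phi_0$ is uniquely determined (up to equality for almost every $x\in\Omega$), and $T\phi_0=P_W[(a^{(1)})^{1/2}\nabla_x\phi_0]$, where $P_W$ acts in $y$ for each $x$. Moreover there is a unique corrector $\phi_1\in C_0^\infty(\Omega;V^\perp)$ such that, for all $x\in\Omega$, $$P_W\big[(a^{(1)})^{1/2}\nabla_x\phi_0\big]=(a^{(1)})^{1/2}\big(\nabla_x\phi_0+\nabla_y\phi_1\big)\quad\text{in } (L^2_\#(Q))^{n\times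 d}.$$ For every $x\in\Omega$, $\phi_1(x,\cdot)$ is the unique $v\in V^\perp$ that solves the cell problem $\mathrm{div}_y\big(a^{(1)}(\nabla_x\phi_0(x,\cdot)+\nabla_y v)\big)=0$ in $(H^{-1}_\#(Q))^n$. -/

import Mathlib

open MeasureTheory Set Filter
open scoped ENNReal ContDiff RealInnerProductSpace MatrixOrder

namespace TwoScale

noncomputable section

/-- The physical space `ℝ^d`. -/
abbrev Pt (d : ℕ) := EuclideanSpace ℝ (Fin d)

/-- The standard basis vector `e_j` of `ℝ^d`. -/
abbrev basisVec {d : ℕ} (j : Fin d) : Pt d := EuclideanSpace.single j (1 : ℝ)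

/-- The periodicity cell `Q = [0,1]^d`. -/
def cell (d : ℕ) : Set (Pt d) := {y | ∀ j, y j ∈ Icc (0 : ℝ) 1}

/-- Lebesgue measure on the cell. -/
abbrev cellMeasure (d : ℕ) : Measure (Pt d) := volume.restrict (cell d)

/-- The tensors `ζ = (ζ_{ij}) ∈ ℝ^{n × d}` with the Frobenius inner product `ζ_{ij} ζ'_{ij}`. -/
abbrev Ten (n d : ℕ) := EuclideanSpace ℝ (Fin n × Fin d)

/-- `(L²_#(Q))^n`. A periodic function is identified with its restriction to the cell. -/
abbrev VecL2 (n d : ℕ) := Lp (EuclideanSpace ℝ (Fin n)) 2 (cellMeasure d)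

/-- `(L²_#(Q))^{n × d}`, with its standard inner product `∫_Q ψ_{ij} ψ'_{ij} dy`. -/
abbrev TenL2 (n d : ℕ) := Lp (Ten n d) 2 (cellMeasure d)

/-! ### Compactness of the cell -/

theorem cell_isCompact (d : ℕ) : IsCompact (cell d) := by
  have h : cell d = (EuclideanSpace.equiv (Fin d) ℝ) ⁻¹' (Icc (fun _ => 0) (fun _ => 1)) := by
    ext y
    simp only [cell, Set.mem_ofPred_eq, Set.mem_preimage, Set.mem_Icc, Pi.le_def]
    exact ⟨fun h => ⟨fun i => (h i).1, fun i => (h i).2⟩, fun h i => ⟨h.1 i, h.2 i⟩⟩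
  rw [h]
  exact (EuclideanSpace.equiv (Fin d) ℝ).toHomeomorph.isCompact_preimage.2 isCompact_Icc

instance (d : ℕ) : IsFiniteMeasure (cellMeasure d) :=
  ⟨by simpa using (cell_isCompact d).measure_lt_top⟩

/-! ### The periodic Sobolev space -/

/-- Scalar test functions of `C^∞_#(Q)`: smooth functions on `ℝ^d` of period one in each
coordinate. -/
structure IsPeriodicTest {d : ℕ} (φ : Pt d → ℝ) : Prop where
  smooth : ContDiff ℝ ∞ φ
  periodic : ∀ (y : Pt d) (j : Fin d), φ (y + basisVec j) = φ y

/-- `G = ∇_y v` in the weak sense on the periodicity torus: for all periodic smooth `φ` and all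
`i, j`, `∫_Q v_i ∂_j φ dy = - ∫_Q G_{ij} φ dy`. -/
def IsWeakGrad {n d : ℕ} (v : VecL2 n d) (G : TenL2 n d) : Prop :=
  ∀ φ : Pt d → ℝ, IsPeriodicTest φ → ∀ (i : Fin n) (j : Fin d),
    ∫ y, v y i * fderiv ℝ φ y (basisVec j) ∂(cellMeasure d) =
      - ∫ y, G y (i, j) * φ y ∂(cellMeasure d)

theorem integrable_coord_mul {ι : Type} [Fintype ι] {d : ℕ}
    (f : Lp (EuclideanSpace ℝ ι) 2 (cellMeasure d)) (i : ι) {g : Pt d → ℝ} (hg : Continuous g) :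
    Integrable (fun y => f y i * g y) (cellMeasure d) := by
  have h1 : Integrable (fun y => f y i) (cellMeasure d) :=
    (EuclideanSpace.proj (𝕜 := ℝ) i).integrable_comp ((Lp.memLp f).integrable (by norm_num))
  obtain ⟨C, hC⟩ := (cell_isCompact d).exists_bound_of_continuousOn hg.continuousOn
  refine h1.mul_bdd (c := C) hg.aestronglyMeasurable ?_
  exact (ae_restrict_iff' (cell_isCompact d).measurableSet).2 (Eventually.of_forall hC)

/-- The Sobolev space `(H^1_#(Q))^n`, as the closed subspace of all pairs `(v, ∇_y v)` in
`(L²_#(Q))^n × (L²_#(Q))^{n × d}`. It carries the standard inner product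
`∫_Q v · w dy + ∫_Q ∇_y v · ∇_y w dy`. -/
def H1 (n d : ℕ) : Submodule ℝ (WithLp 2 (VecL2 n d × TenL2 n d)) where
  carrier := {p | IsWeakGrad p.fst p.snd}
  zero_mem' := by
    intro φ hφ i j
    have h1 : ∀ᵐ y ∂(cellMeasure d), ((0 : VecL2 n d) : Pt d → _) y = 0 := by
      filter_upwards [Lp.coeFn_zero (EuclideanSpace ℝ (Fin n)) 2 (cellMeasure d)] with y hy
      simpa using hy
    have h2 : ∀ᵐ y ∂(cellMeasure d), ((0 : TenL2 n d) : Pt d → _) y = 0 := by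
      filter_upwards [Lp.coeFn_zero (Ten n d) 2 (cellMeasure d)] with y hy
      simpa using hy
    have e1 := integral_congr_ae (μ := cellMeasure d)
      (f := fun y => ((0 : VecL2 n d) : Pt d → _) y i * fderiv ℝ φ y (basisVec j))
      (g := fun _ => 0) (by filter_upwards [h1] with y hy; simp only [hy, PiLp.zero_apply, zero_mul])
    have e2 := integral_congr_ae (μ := cellMeasure d)
      (f := fun y => ((0 : TenL2 n d) : Pt d → _) y (i, j) * φ y)
      (g := fun _ => 0) (by filter_upwards [h2] with y hy; simp only [hy, PiLp.zero_apply, zero_mul])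
    simp only [WithLp.zero_fst, WithLp.zero_snd]
    rw [e1, e2]; simp
  add_mem' := by
    intro p q hp hq φ hφ i j
    have hc : Continuous (fun y => fderiv ℝ φ y (basisVec j)) :=
      (hφ.smooth.continuous_fderiv (by simp)).clm_apply continuous_const
    have e1 := integral_congr_ae (μ := cellMeasure d)
      (f := fun y => (p.fst + q.fst) y i * fderiv ℝ φ y (basisVec j))
      (g := fun y => p.fst y i * fderiv ℝ φ y (basisVec j)
        + q.fst y i * fderiv ℝ φ y (basisVec j))
      (by filter_upwards [Lp.coeFn_add p.fst q.fst] with y hy; simp only [hy, Pi.add_apply, PiLp.add_apply, add_mul])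
    have e2 := integral_congr_ae (μ := cellMeasure d)
      (f := fun y => (p.snd + q.snd) y (i, j) * φ y)
      (g := fun y => p.snd y (i, j) * φ y + q.snd y (i, j) * φ y)
      (by filter_upwards [Lp.coeFn_add p.snd q.snd] with y hy; simp only [hy, Pi.add_apply, PiLp.add_apply, add_mul])
    simp only [WithLp.add_fst, WithLp.add_snd]
    rw [e1, e2, integral_add (integrable_coord_mul _ _ hc) (integrable_coord_mul _ _ hc),
      integral_add (integrable_coord_mul _ _ hφ.smooth.continuous)
        (integrable_coord_mul _ _ hφ.smooth.continuous), hp φ hφ i j, hq φ hφ i j]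
    ring
  smul_mem' := by
    intro c p hp φ hφ i j
    have e1 := integral_congr_ae (μ := cellMeasure d)
      (f := fun y => (c • p.fst) y i * fderiv ℝ φ y (basisVec j))
      (g := fun y => c * (p.fst y i * fderiv ℝ φ y (basisVec j)))
      (by filter_upwards [Lp.coeFn_smul c p.fst] with y hy; simp only [hy, Pi.smul_apply, PiLp.smul_apply, smul_eq_mul, mul_assoc])
    have e2 := integral_congr_ae (μ := cellMeasure d)
      (f := fun y => (c • p.snd) y (i, j) * φ y)
      (g := fun y => c * (p.snd y (i, j) * φ y))
      (by filter_upwards [Lp.coeFn_smul c p.snd] with y hy; simp only [hy, Pi.smul_apply, PiLp.smul_apply, smul_eq_mul, mul_assoc])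
    simp only [WithLp.smul_fst, WithLp.smul_snd]
    rw [e1, e2, integral_const_mul, integral_const_mul, hp φ hφ i j]
    ring

/-- The inclusion `(H^1_#(Q))^n → (L²_#(Q))^n`. -/
def incl (n d : ℕ) : H1 n d →L[ℝ] VecL2 n d :=
  (WithLp.fstL 2 ℝ (VecL2 n d) (TenL2 n d)).comp (H1 n d).subtypeL

/-- The gradient `∇_y : (H^1_#(Q))^n → (L²_#(Q))^{n × d}`, `(∇_y v)_{ij} = ∂v_i/∂y_j`. -/
def gradY (n d : ℕ) : H1 n d →L[ℝ] TenL2 n d :=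
  (WithLp.sndL 2 ℝ (VecL2 n d) (TenL2 n d)).comp (H1 n d).subtypeL

/-! ### The degenerate tensor and its square root -/

/-- A symmetric non-negative tensor `a = (a_{ijpq}) ∈ (L^∞_#(Q))^{n × d × n × d}`. The entry
`a_{ijpq}(y)` is `coeff y (i, j) (p, q)`. -/
structure DegTensor (n d : ℕ) where
  coeff : Pt d → Matrix (Fin n × Fin d) (Fin n × Fin d) ℝ
  bounded : ∀ r s, MemLp (fun y => coeff y r s) ∞ (cellMeasure d)
  symm : ∀ᵐ y ∂(cellMeasure d), ∀ (i p : Fin n) (j q : Fin d),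
    coeff y (i, j) (p, q) = coeff y (p, q) (i, j)
  nonneg : ∀ᵐ y ∂(cellMeasure d), ∀ ζ : Fin n → Fin d → ℝ,
    0 ≤ ∑ i, ∑ j, ∑ p, ∑ q, coeff y (i, j) (p, q) * ζ i j * ζ p q

theorem DegTensor.posSemidef {n d : ℕ} (a : DegTensor n d) :
    ∀ᵐ y ∂(cellMeasure d), (a.coeff y).PosSemidef := by
  filter_upwards [a.symm, a.nonneg] with y h1 h2
  refine Matrix.PosSemidef.of_dotProduct_mulVec_nonneg ?_ ?_
  · ext ⟨i, j⟩ ⟨p, q⟩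
    simpa using h1 p i q j
  · intro x
    have := h2 (fun i j => x (i, j))
    refine this.trans_eq ?_
    simp only [dotProduct, Matrix.mulVec, Fintype.sum_prod_type, Finset.mul_sum, star_trivial]
    refine Finset.sum_congr rfl fun i _ => Finset.sum_congr rfl fun j _ =>
      Finset.sum_congr rfl fun p _ => Finset.sum_congr rfl fun q _ => ?_
    ring

theorem isClosed_posSemidef (ι : Type) [Fintype ι] :
    IsClosed {b : ι → ι → ℝ | (Matrix.of b).PosSemidef} := by
  have h : {b : ι → ι → ℝ | (Matrix.of b).PosSemidef} =
      {b | ∀ r s, b r s = b s r} ∩ {b | ∀ x : ι → ℝ, 0 ≤ ∑ r, x r * ∑ s, b r s * x s} := by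
    ext b
    constructor
    · intro hb
      refine ⟨fun r s => ?_, fun x => ?_⟩
      · simpa using hb.isHermitian.apply s r
      · simpa [dotProduct, Matrix.mulVec] using hb.dotProduct_mulVec_nonneg x
    · rintro ⟨h1, h2⟩
      refine Matrix.PosSemidef.of_dotProduct_mulVec_nonneg ?_ ?_
      · ext r s
        simpa using h1 s r
      · intro x
        simpa [dotProduct, Matrix.mulVec] using h2 x
  rw [h]
  refine IsClosed.inter ?_ ?_
  · simp only [Set.ofPred_forall]
    exact isClosed_iInter fun r => isClosed_iInter fun s =>
      isClosed_eq (by fun_prop) (by fun_prop)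
  · simp only [Set.ofPred_forall]
    exact isClosed_iInter fun x => isClosed_le (by fun_prop) (by fun_prop)

theorem aemeasurable_sqrt {X ι : Type} [MeasurableSpace X] [Fintype ι] [DecidableEq ι]
    {μ : Measure X} {m : X → Matrix ι ι ℝ} (hm : ∀ r s, AEMeasurable (fun y => m y r s) μ)
    (hp : ∀ᵐ y ∂μ, (m y).PosSemidef) (r s : ι) :
    AEMeasurable (fun y => CFC.sqrt (m y) r s) μ := by
  classical
  let S : Set (ι → ι → ℝ) := {b | (Matrix.of b).PosSemidef}
  have hS : MeasurableSet S := (isClosed_posSemidef ι).measurableSet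
  have : StandardBorelSpace S := hS.standardBorel
  let f : S → (ι → ι → ℝ) := fun b => Matrix.of.symm (Matrix.of b.1 * Matrix.of b.1)
  have hf : Measurable f := by
    refine measurable_pi_iff.2 fun r => measurable_pi_iff.2 fun s => ?_
    simp only [f, Matrix.of_symm_apply, Matrix.mul_apply, Matrix.of_apply]
    refine Finset.measurable_sum _ fun j _ => Measurable.mul ?_ ?_
    · exact (measurable_pi_apply j).comp ((measurable_pi_apply r).comp measurable_subtype_coe)
    · exact (measurable_pi_apply s).comp ((measurable_pi_apply j).comp measurable_subtype_coe)
  have hinj : Function.Injective f := by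
    intro b c hbc
    have h1 : Matrix.of b.1 * Matrix.of b.1 = Matrix.of c.1 * Matrix.of c.1 := hbc
    have h2 := CFC.sqrt_mul_self (Matrix.of b.1) (ha := b.2.nonneg)
    have h3 := CFC.sqrt_mul_self (Matrix.of c.1) (ha := c.2.nonneg)
    apply Subtype.ext
    apply Matrix.of.injective
    rw [← h2, ← h3, h1]
  have hemb := hf.measurableEmbedding hinj
  let g : X → ι → ι → ℝ := fun y r s => m y r s
  have hg : AEMeasurable g μ := aemeasurable_pi_iff.2 fun r => aemeasurable_pi_iff.2 fun s => hm r s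
  let t : X → ι → ι → ℝ := fun y => if hg.mk g y ∈ S then hg.mk g y else 0
  have ht : Measurable t := Measurable.ite (hg.measurable_mk hS) hg.measurable_mk measurable_const
  have htS : ∀ y, t y ∈ S := by
    intro y
    by_cases h : hg.mk g y ∈ S
    · simp only [t, if_pos h]; exact h
    · simp only [t, if_neg h]
      exact Matrix.PosSemidef.zero
  let σ : X → S := fun y => ⟨Matrix.of.symm (CFC.sqrt (Matrix.of (t y))),
    Matrix.nonneg_iff_posSemidef.1 (CFC.sqrt_nonneg (Matrix.of (t y)))⟩
  have hσ : Measurable σ := by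
    rw [← hemb.measurable_comp_iff]
    have : f ∘ σ = t := by
      funext y
      exact congrArg Matrix.of.symm
        (CFC.sqrt_mul_sqrt_self (Matrix.of (t y)) (ha := (htS y).nonneg))
    rw [this]; exact ht
  refine ⟨fun y => (σ y).1 r s, ?_, ?_⟩
  · exact (measurable_pi_iff.1 (measurable_pi_iff.1 (measurable_subtype_coe.comp hσ) r) s)
  · filter_upwards [hp, hg.ae_eq_mk] with y hy1 hy2
    have h1 : hg.mk g y ∈ S := by rw [← hy2]; exact hy1
    have h2 : t y = g y := by simp only [t, if_pos h1, hy2]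
    simp only [σ, h2]
    rfl

theorem DegTensor.memLp_sqrt {n d : ℕ} (a : DegTensor n d) (r s : Fin n × Fin d) :
    MemLp (fun y => CFC.sqrt (a.coeff y) r s) ∞ (cellMeasure d) := by
  have hm := aemeasurable_sqrt (fun r s => (a.bounded r s).aestronglyMeasurable.aemeasurable)
    a.posSemidef r s
  have htr : MemLp (fun y => 1 + (a.coeff y).trace) ∞ (cellMeasure d) := by
    refine (memLp_top_const (1 : ℝ)).add ?_
    exact memLp_finsetSum Finset.univ fun r _ => a.bounded r r
  refine htr.mono hm.aestronglyMeasurable ?_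
  filter_upwards [a.posSemidef] with y hy
  have h0 := Matrix.nonneg_iff_posSemidef.1 (CFC.sqrt_nonneg (a.coeff y))
  have h1 := CFC.sqrt_mul_sqrt_self (a.coeff y) (ha := hy.nonneg)
  set b := CFC.sqrt (a.coeff y)
  have h2 : (a.coeff y).trace = ∑ r, ∑ s, b r s ^ 2 := by
    rw [← h1, Matrix.trace]
    refine Finset.sum_congr rfl fun r _ => ?_
    rw [Matrix.diag_apply, Matrix.mul_apply]
    refine Finset.sum_congr rfl fun s _ => ?_
    have : b s r = b r s := by simpa using h0.isHermitian.apply r s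
    rw [this, sq]
  have h3 : b r s ^ 2 ≤ (a.coeff y).trace := by
    rw [h2]
    refine le_trans ?_ (Finset.single_le_sum
      (f := fun r => ∑ s, b r s ^ 2) (fun r _ => by positivity) (Finset.mem_univ r))
    exact Finset.single_le_sum (f := fun s => b r s ^ 2) (fun s _ => by positivity)
      (Finset.mem_univ s)
  have h4 : 0 ≤ (a.coeff y).trace := le_trans (sq_nonneg _) h3
  rw [Real.norm_eq_abs, Real.norm_eq_abs, abs_of_nonneg (by linarith : 0 ≤ 1 + (a.coeff y).trace)]
  refine abs_le.2 ⟨?_, ?_⟩ <;> nlinarith [sq_nonneg (b r s - 1), sq_nonneg (b r s + 1)]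

theorem memLp_sum_smul {X Y ι : Type*} [MeasurableSpace X] [Fintype ι] {μ : Measure X}
    [NormedAddCommGroup Y] [NormedSpace ℝ Y] {m : X → Matrix ι ι ℝ}
    (hm : ∀ r s, MemLp (fun y => m y r s) ∞ μ) (c : ι → ι → Y) :
    MemLp (fun y => ∑ r, ∑ s, m y r s • c r s) ∞ μ := by
  refine memLp_finsetSum _ fun r _ => memLp_finsetSum _ fun s _ => ?_
  exact (memLp_top_const (c r s)).smul (hm r s)

theorem memLp_toCLM {n d : ℕ} {m : Pt d → Matrix (Fin n × Fin d) (Fin n × Fin d) ℝ}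
    (hm : ∀ r s, MemLp (fun y => m y r s) ∞ (cellMeasure d)) :
    MemLp (fun y => Matrix.toEuclideanCLM (n := Fin n × Fin d) (𝕜 := ℝ) (m y)) ∞
      (cellMeasure d) := by
  have h : (fun y => Matrix.toEuclideanCLM (n := Fin n × Fin d) (𝕜 := ℝ) (m y)) =
      fun y => ∑ r, ∑ s, m y r s • Matrix.toEuclideanCLM (n := Fin n × Fin d) (𝕜 := ℝ)
        (Matrix.single r s (1 : ℝ)) := by
    funext y
    conv_lhs => rw [Matrix.matrix_eq_sum_single (m y)]
    simp only [map_sum]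
    refine Finset.sum_congr rfl fun r _ => Finset.sum_congr rfl fun s _ => ?_
    rw [← map_smul, Matrix.smul_single, smul_eq_mul, mul_one]
  rw [h]
  exact memLp_sum_smul hm _

/-- Multiplication of `L²` tensor fields by a bounded field `m = (m_{ijpq}(y))`:
`(m ψ)_{ij}(y) = m_{ijpq}(y) ψ_{pq}(y)`. -/
def mulOp {n d : ℕ} (m : Pt d → Matrix (Fin n × Fin d) (Fin n × Fin d) ℝ)
    (hm : ∀ r s, MemLp (fun y => m y r s) ∞ (cellMeasure d)) : TenL2 n d →L[ℝ] TenL2 n d :=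
  (ContinuousLinearMap.id ℝ (Ten n d →L[ℝ] Ten n d)).holderL (cellMeasure d) ∞ 2 2
    ((memLp_toCLM hm).toLp _)

theorem mulOp_apply {n d : ℕ} (m : Pt d → Matrix (Fin n × Fin d) (Fin n × Fin d) ℝ)
    (hm : ∀ r s, MemLp (fun y => m y r s) ∞ (cellMeasure d)) (ψ : TenL2 n d) :
    ∀ᵐ y ∂(cellMeasure d), ∀ i j,
      mulOp m hm ψ y (i, j) = ∑ p, ∑ q, m y (i, j) (p, q) * ψ y (p, q) := by
  filter_upwards [(ContinuousLinearMap.id ℝ (Ten n d →L[ℝ] Ten n d)).coeFn_holder (r := 2)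
    ((memLp_toCLM hm).toLp _) ψ, (memLp_toCLM hm).coeFn_toLp] with y h1 h2 i j
  have h3 : mulOp m hm ψ y = Matrix.toEuclideanCLM (n := Fin n × Fin d) (𝕜 := ℝ) (m y) (ψ y) := by
    refine h1.trans ?_
    rw [h2]; rfl
  rw [h3, Matrix.ofLp_toEuclideanCLM, Matrix.mulVec, dotProduct, Fintype.sum_prod_type]

/-- Multiplication by `a`. -/
def DegTensor.op {n d : ℕ} (a : DegTensor n d) : TenL2 n d →L[ℝ] TenL2 n d :=
  mulOp a.coeff a.bounded

/-- Multiplication by `a^{1/2}`, the pointwise non-negative square root of `a`. -/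
def DegTensor.sqrtOp {n d : ℕ} (a : DegTensor n d) : TenL2 n d →L[ℝ] TenL2 n d :=
  mulOp (fun y => CFC.sqrt (a.coeff y)) a.memLp_sqrt

/-! ### The spaces `V`, `V^⊥`, `W` and the key assumption -/

/-- `V = {v ∈ (H^1_#(Q))^n : a ∇_y v = 0}`. -/
def spaceV {n d : ℕ} (a : DegTensor n d) : Submodule ℝ (H1 n d) :=
  LinearMap.ker (a.op.comp (gradY n d)).toLinearMap

/-- The orthogonal complement of `V` in `(H^1_#(Q))^n` with respect to the inner product `B`. -/
def spaceVperp {n d : ℕ} (a : DegTensor n d) (B : H1 n d →L[ℝ] H1 n d →L[ℝ] ℝ) :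
    Submodule ℝ (H1 n d) where
  carrier := {w | ∀ v ∈ spaceV a, B w v = 0}
  zero_mem' := by intro v _; simp
  add_mem' := by intro w w' h h' v hv; simp [h v hv, h' v hv]
  smul_mem' := by intro c w h v hv; simp [h v hv]

/-- `B` is an inner product on `(H^1_#(Q))^n` whose norm is equivalent to the standard one. -/
structure IsEquivInner {n d : ℕ} (B : H1 n d →L[ℝ] H1 n d →L[ℝ] ℝ) : Prop where
  symm : ∀ v w, B v w = B w v
  coercive : IsCoercive B

/-- `div_y g = 0` in `(H^{-1}_#(Q))^n`, the dual of `(H^1_#(Q))^n`. -/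
def DivFree {n d : ℕ} (g : TenL2 n d) : Prop :=
  ∀ w : H1 n d, ⟪g, gradY n d w⟫ = 0

/-- `W = {ψ ∈ (L²_#(Q))^{n × d} : div_y (a^{1/2} ψ) = 0 in (H^{-1}_#(Q))^n}`. -/
def spaceW {n d : ℕ} (a : DegTensor n d) : Submodule ℝ (TenL2 n d) where
  carrier := {ψ | DivFree (a.sqrtOp ψ)}
  zero_mem' := by intro w; simp
  add_mem' := by
    intro ψ ψ' h h' w
    rw [map_add, inner_add_left, h w, h' w, add_zero]
  smul_mem' := by
    intro c ψ h w
    rw [map_smul, real_inner_smul_left, h w, mul_zero]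

theorem spaceW_isClosed {n d : ℕ} (a : DegTensor n d) :
    IsClosed (spaceW a : Set (TenL2 n d)) := by
  have h : (spaceW a : Set (TenL2 n d)) =
      ⋂ w : H1 n d, {ψ | ⟪a.sqrtOp ψ, gradY n d w⟫ = 0} := by
    ext ψ
    simp only [Set.mem_iInter, Set.mem_ofPred_eq]
    rfl
  rw [h]
  exact isClosed_iInter fun w =>
    isClosed_eq (a.sqrtOp.continuous.inner continuous_const) continuous_const

instance {n d : ℕ} (a : DegTensor n d) : CompleteSpace (spaceW a) :=
  (spaceW_isClosed a).completeSpace_coe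

/-- The orthogonal projector `P_W` of `(L²_#(Q))^{n × d}` on `W`. -/
def projW {n d : ℕ} (a : DegTensor n d) : TenL2 n d →L[ℝ] TenL2 n d :=
  (spaceW a).starProjection

/-- The key assumption on the degeneracy: for some `C > 0`, each `v ∈ (H^1_#(Q))^n` admits
`v₁ ∈ V` with `‖v - v₁‖_{H^1} ≤ C ‖a ∇_y v‖_{L²}`. -/
def KeyAssumption {n d : ℕ} (a : DegTensor n d) : Prop :=
  ∃ C : ℝ, 0 < C ∧ ∀ v : H1 n d, ∃ v₁ ∈ spaceV a, ‖v - v₁‖ ≤ C * ‖a.op (gradY n d v)‖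

/-! ### Two-scale functions -/

/-- `φ ∈ C_0^∞(Ω; S)`, extended by zero outside `Ω`. -/
structure IsTest {d : ℕ} {X : Type*} [NormedAddCommGroup X] [NormedSpace ℝ X]
    (Ω : Set (Pt d)) (S : Submodule ℝ X) (φ : Pt d → X) : Prop where
  smooth : ContDiff ℝ ∞ φ
  hasCompactSupport : HasCompactSupport φ
  support_subset : tsupport φ ⊆ Ω
  mem : ∀ x, φ x ∈ S

/-- Placing a vector `v ∈ ℝ^n` in the `j`-th column of a tensor: `ζ_{iq} = v_i δ_{jq}`. -/
def toColumn (n : ℕ) {d : ℕ} (j : Fin d) : EuclideanSpace ℝ (Fin n) →L[ℝ] Ten n d :=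
  LinearMap.toContinuousLinearMap
    { toFun := fun v => WithLp.toLp 2 fun iq => if iq.2 = j then v iq.1 else 0
      map_add' := by intro v w; ext iq; by_cases h : iq.2 = j <;> simp [h]
      map_smul' := by intro c v; ext iq; by_cases h : iq.2 = j <;> simp [h] }

/-- The `j`-th column of a tensor: `v_i = ζ_{ij}`. -/
def column (n : ℕ) {d : ℕ} (j : Fin d) : Ten n d →L[ℝ] EuclideanSpace ℝ (Fin n) :=
  LinearMap.toContinuousLinearMap
    { toFun := fun ζ => WithLp.toLp 2 fun i => ζ (i, j)
      map_add' := by intro v w; ext i; simp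
      map_smul' := by intro c v; ext i; simp }

/-- `(∇_x φ)(x, ·) ∈ (L²_#(Q))^{n × d}`, `(∇_x φ)_{ij} = ∂φ_i/∂x_j`. -/
def gradX {n d : ℕ} (φ : Pt d → H1 n d) (x : Pt d) : TenL2 n d :=
  ∑ j, (toColumn n j).compLp (incl n d (fderiv ℝ φ x (basisVec j)))

/-- `(div_x Ψ)(x, ·) ∈ (L²_#(Q))^n`, `(div_x Ψ)_i = ∂Ψ_{ij}/∂x_j`. -/
def divX {n d : ℕ} (Ψ : Pt d → TenL2 n d) (x : Pt d) : VecL2 n d :=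
  ∑ j, (column n j).compLp (fderiv ℝ Ψ x (basisVec j))

/-- `u ∈ U` and `ξ = T u`: `u ∈ L²(Ω; V)`, `ξ ∈ L²(Ω; W)` and
`∫_Ω ∫_Q ξ · Ψ = - ∫_Ω ∫_Q u · div_x (a^{1/2} Ψ)` for all `Ψ ∈ C^∞(Ω; W)` which are
square integrable together with their first derivatives. No boundary condition is imposed on
`Ψ`. -/
structure IsT {n d : ℕ} (a : DegTensor n d) (Ω : Set (Pt d))
    (u : Pt d → H1 n d) (ξ : Pt d → TenL2 n d) : Prop where
  memLp_u : MemLp u 2 (volume.restrict Ω)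
  u_mem : ∀ᵐ x ∂(volume.restrict Ω), u x ∈ spaceV a
  memLp_flux : MemLp ξ 2 (volume.restrict Ω)
  flux_mem : ∀ᵐ x ∂(volume.restrict Ω), ξ x ∈ spaceW a
  identity : ∀ Ψ : Pt d → TenL2 n d, ContDiffOn ℝ ∞ Ψ Ω → (∀ x ∈ Ω, Ψ x ∈ spaceW a) →
    MemLp Ψ 2 (volume.restrict Ω) → MemLp (fderiv ℝ Ψ) 2 (volume.restrict Ω) →
    ∫ x in Ω, ⟪ξ x, Ψ x⟫ =
      - ∫ x in Ω, ⟪incl n d (u x), divX (fun x' => a.sqrtOp (Ψ x')) x⟫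

/-- `φ₁` is a corrector for `φ₀`: `φ₁ ∈ C_0^∞(Ω; V^⊥)` and
`P_W [a^{1/2} ∇_x φ₀] = a^{1/2} (∇_x φ₀ + ∇_y φ₁)` for every `x ∈ Ω`. -/
structure IsCorrector {n d : ℕ} (a : DegTensor n d) (B : H1 n d →L[ℝ] H1 n d →L[ℝ] ℝ)
    (Ω : Set (Pt d)) (φ₀ φ₁ : Pt d → H1 n d) : Prop where
  test : IsTest Ω (spaceVperp a B) φ₁
  flux_eq : ∀ x ∈ Ω,
    projW a (a.sqrtOp (gradX φ₀ x)) = a.sqrtOp (gradX φ₀ x + gradY n d (φ₁ x))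

end

end TwoScale

namespace TwoScale

/-! ### Multiplication operators -/

/-! Put `K = a^{1/2} ∇_y`, which is `a.sqrtGrad`. Since `a^{1/2}` is self-adjoint with square `a`,
`V` is the kernel of `K` and `W` the orthogonal complement of its range (`mem_spaceV_iff`,
`mem_spaceW_iff`). The cell problem says that `a^{1/2} ∇_x φ₀ + K v` lies in `W`, and then this sum
must be the projection of `a^{1/2} ∇_x φ₀`.

Solvability amounts to `K` having closed range. The key assumption provides it by bounding `K` from
below on `V^⊥` (`exists_norm_le_sqrtGrad`). Lax–Milgram then yields one bounded operator `R` with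
`P_W ψ = ψ + K (R ψ)` (`exists_correctorOp`). As `R` does not depend on `x`, the corrector `R
(a^{1/2} ∇_x φ₀)` inherits smoothness and compact support; it is unique because `K` is injective on
`V^⊥`.

For `T`, integration by parts in `x` and self-adjointness of `P_W` show that the projected flux
satisfies the defining identity. Fields `χ(x) w` with `w ∈ W` suffice to show that nothing else does
(`IsTest.isT_iff`). -/

theorem mulOp_ae_eq {n d : ℕ} (m : Pt d → Matrix (Fin n × Fin d) (Fin n × Fin d) ℝ)
    (hm : ∀ r s, MemLp (fun y => m y r s) ∞ (cellMeasure d)) (ψ : TenL2 n d) :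
    ∀ᵐ y ∂(cellMeasure d),
      mulOp m hm ψ y = Matrix.toEuclideanCLM (n := Fin n × Fin d) (𝕜 := ℝ) (m y) (ψ y) := by
  filter_upwards [mulOp_apply m hm ψ] with y hy
  ext ⟨i, j⟩
  rw [hy, Matrix.ofLp_toEuclideanCLM, Matrix.mulVec, dotProduct, Fintype.sum_prod_type]

theorem inner_mulOp_left {n d : ℕ} {m : Pt d → Matrix (Fin n × Fin d) (Fin n × Fin d) ℝ}
    (hm : ∀ r s, MemLp (fun y => m y r s) ∞ (cellMeasure d))
    (hs : ∀ᵐ y ∂(cellMeasure d), (m y).IsHermitian) (ψ χ : TenL2 n d) :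
    ⟪mulOp m hm ψ, χ⟫ = ⟪ψ, mulOp m hm χ⟫ := by
  rw [L2.inner_def, L2.inner_def]
  refine integral_congr_ae ?_
  filter_upwards [mulOp_ae_eq m hm ψ, mulOp_ae_eq m hm χ, hs] with y h1 h2 h3
  rw [h1, h2, real_inner_comm, Matrix.inner_toEuclideanCLM, Matrix.inner_toEuclideanCLM,
    Matrix.dotProduct_mulVec, ← Matrix.mulVec_transpose]
  have h4 : (m y).transpose = m y := by simpa using h3.eq
  rw [h4, dotProduct_comm]

theorem DegTensor.inner_sqrtOp_left {n d : ℕ} (a : DegTensor n d) (ψ χ : TenL2 n d) :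
    ⟪a.sqrtOp ψ, χ⟫ = ⟪ψ, a.sqrtOp χ⟫ :=
  -- `CFC.sqrt` is positive semidefinite at every matrix, so no exceptional null set arises here;
  -- non-negativity of `a` matters only for squaring back to `a`.
  inner_mulOp_left a.memLp_sqrt (Eventually.of_forall fun y =>
    (Matrix.nonneg_iff_posSemidef.1 (CFC.sqrt_nonneg (a.coeff y))).isHermitian) ψ χ

theorem DegTensor.sqrtOp_sqrtOp {n d : ℕ} (a : DegTensor n d) (ψ : TenL2 n d) :
    a.sqrtOp (a.sqrtOp ψ) = a.op ψ := by
  refine Lp.ext ?_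
  filter_upwards [mulOp_ae_eq a.coeff a.bounded ψ, mulOp_ae_eq _ a.memLp_sqrt ψ,
    mulOp_ae_eq _ a.memLp_sqrt (a.sqrtOp ψ), a.posSemidef] with y h1 h2 h3 h4
  refine h3.trans (Eq.trans ?_ h1.symm)
  rw [DegTensor.sqrtOp, h2, ← mul_apply_eq_comp, ← map_mul,
    CFC.sqrt_mul_sqrt_self _ h4.nonneg]

/-- `toColumn` and `column` are transposes at each point; this is the algebra behind the duality of
`gradX` and `divX`. -/
theorem inner_toColumn_compLp {n d : ℕ} (j : Fin d) (v : VecL2 n d) (ζ : TenL2 n d) :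
    ⟪(toColumn n j).compLp v, ζ⟫ = ⟪v, (column n j).compLp ζ⟫ := by
  rw [L2.inner_def, L2.inner_def]
  refine integral_congr_ae ?_
  filter_upwards [(toColumn n j).coeFn_compLp v, (column n j).coeFn_compLp ζ] with y h1 h2
  rw [h1, h2]
  simp [toColumn, column, PiLp.inner_apply, Fintype.sum_prod_type]

/-! ### Completeness of the periodic Sobolev space -/

/-- The functional is the inner product with `g e_i`, which is square integrable because `g` is
bounded on the compact cell. -/
theorem continuous_integral_coord_mul {ι : Type} [Fintype ι] [DecidableEq ι] {d : ℕ} (i : ι)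
    {g : Pt d → ℝ} (hg : Continuous g) :
    Continuous fun f : Lp (EuclideanSpace ℝ ι) 2 (cellMeasure d) =>
      ∫ y, f y i * g y ∂(cellMeasure d) := by
  obtain ⟨C, hC⟩ := (cell_isCompact d).exists_bound_of_continuousOn hg.continuousOn
  have hmem : MemLp (fun y => g y • EuclideanSpace.single i (1 : ℝ)) 2 (cellMeasure d) := by
    refine MemLp.of_bound (hg.smul continuous_const).aestronglyMeasurable C ?_
    refine (ae_restrict_iff' (cell_isCompact d).measurableSet).2 (Eventually.of_forall ?_)
    intro y hy
    simpa [norm_smul] using hC y hy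
  have h : (fun f : Lp (EuclideanSpace ℝ ι) 2 (cellMeasure d) =>
      ∫ y, f y i * g y ∂(cellMeasure d)) = fun f => ⟪hmem.toLp _, f⟫ := by
    funext f
    rw [L2.inner_def]
    refine integral_congr_ae ?_
    filter_upwards [hmem.coeFn_toLp] with y hy
    rw [hy, real_inner_smul_left, EuclideanSpace.inner_single_left]
    simp [mul_comm]
  rw [h]
  exact continuous_const.inner continuous_id

/-- Each test function and index pair imposes one continuous linear equation. The resulting
completeness is what Lax–Milgram needs. -/
theorem H1_isClosed (n d : ℕ) : IsClosed (H1 n d : Set (WithLp 2 (VecL2 n d × TenL2 n d))) := by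
  have h : (H1 n d : Set (WithLp 2 (VecL2 n d × TenL2 n d))) =
      ⋂ (φ : Pt d → ℝ) (_ : IsPeriodicTest φ) (i : Fin n) (j : Fin d),
        {p | ∫ y, p.fst y i * fderiv ℝ φ y (basisVec j) ∂(cellMeasure d) =
          - ∫ y, p.snd y (i, j) * φ y ∂(cellMeasure d)} := by
    ext p
    simp only [Set.mem_iInter, Set.mem_ofPred_eq]
    rfl
  rw [h]
  refine isClosed_iInter fun φ => isClosed_iInter fun hφ => isClosed_iInter fun i =>
    isClosed_iInter fun j => isClosed_eq ?_ ?_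
  · have hc : Continuous (fun y => fderiv ℝ φ y (basisVec j)) :=
      (hφ.smooth.continuous_fderiv (by simp)).clm_apply continuous_const
    exact (continuous_integral_coord_mul i hc).comp
      (WithLp.fstL 2 ℝ (VecL2 n d) (TenL2 n d)).continuous
  · exact ((continuous_integral_coord_mul (i, j) hφ.smooth.continuous).comp
      (WithLp.sndL 2 ℝ (VecL2 n d) (TenL2 n d)).continuous).neg

instance (n d : ℕ) : CompleteSpace (H1 n d) := (H1_isClosed n d).completeSpace_coe

/-! ### The spaces `V` and `V^⊥` -/

/-- The operator `v ↦ a^{1/2} ∇_y v`, whose kernel is `V`. -/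
noncomputable def DegTensor.sqrtGrad {n d : ℕ} (a : DegTensor n d) : H1 n d →L[ℝ] TenL2 n d :=
  a.sqrtOp.comp (gradY n d)

theorem DegTensor.sqrtGrad_apply {n d : ℕ} (a : DegTensor n d) (v : H1 n d) :
    a.sqrtGrad v = a.sqrtOp (gradY n d v) := rfl

/-- The kernels of `a` and `a^{1/2}` agree because `‖a^{1/2} G‖² = ⟪G, a G⟫`. -/
theorem mem_spaceV_iff {n d : ℕ} (a : DegTensor n d) (v : H1 n d) :
    v ∈ spaceV a ↔ a.sqrtGrad v = 0 := by
  have h0 : v ∈ spaceV a ↔ a.op (gradY n d v) = 0 := Iff.rfl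
  rw [h0, a.sqrtGrad_apply, ← a.sqrtOp_sqrtOp]
  refine ⟨fun h => ?_, fun h => by rw [h, map_zero]⟩
  rw [← inner_self_eq_zero (𝕜 := ℝ), a.inner_sqrtOp_left, h, inner_zero_right]

/-- Self-adjointness moves the weight onto the gradient, so `W` is the orthogonal complement of the
range of `a.sqrtGrad`. -/
theorem mem_spaceW_iff {n d : ℕ} (a : DegTensor n d) (ψ : TenL2 n d) :
    ψ ∈ spaceW a ↔ ∀ w, ⟪ψ, a.sqrtGrad w⟫ = 0 :=
  forall_congr' fun w => by rw [a.sqrtGrad_apply, a.inner_sqrtOp_left]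

theorem divFree_op_iff {n d : ℕ} (a : DegTensor n d) (g : TenL2 n d) (v : H1 n d) :
    DivFree (a.op (g + gradY n d v)) ↔ a.sqrtOp g + a.sqrtGrad v ∈ spaceW a := by
  rw [← a.sqrtOp_sqrtOp, map_add]
  rfl

theorem spaceV_isClosed {n d : ℕ} (a : DegTensor n d) : IsClosed (spaceV a : Set (H1 n d)) :=
  (a.op.comp (gradY n d)).isClosed_ker

theorem spaceVperp_isClosed {n d : ℕ} (a : DegTensor n d) (B : H1 n d →L[ℝ] H1 n d →L[ℝ] ℝ) :
    IsClosed (spaceVperp a B : Set (H1 n d)) := by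
  have h : (spaceVperp a B : Set (H1 n d)) = ⋂ v ∈ spaceV a, {w | B w v = 0} := by
    ext w
    simp only [Set.mem_iInter, Set.mem_ofPred_eq]
    rfl
  rw [h]
  exact isClosed_biInter fun v _ => isClosed_eq (by fun_prop) continuous_const

theorem eq_zero_of_mem_spaceV_of_mem_spaceVperp {n d : ℕ} {a : DegTensor n d}
    {B : H1 n d →L[ℝ] H1 n d →L[ℝ] ℝ} (hB : IsEquivInner B) {v : H1 n d} (h1 : v ∈ spaceV a)
    (h2 : v ∈ spaceVperp a B) : v = 0 := by
  obtain ⟨C, hC, h⟩ := hB.coercive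
  have h3 := h v
  rw [h2 v h1] at h3
  by_contra h4
  have : 0 < ‖v‖ := norm_pos_iff.2 h4
  exact absurd h3 (not_le.2 (by positivity))

/-! ### Abstract degenerate coercivity -/

section Abstract

variable {H L : Type*} [NormedAddCommGroup H] [InnerProductSpace ℝ H]
  [NormedAddCommGroup L] [InnerProductSpace ℝ L]

/-- Orthogonality is meant for `B`, not for the ambient inner product, so the projection on `V`
comes from Lax–Milgram on `V` applied to the functional `B w`. -/
theorem exists_sub_perp [CompleteSpace H] {B : H →L[ℝ] H →L[ℝ] ℝ} (hB : IsCoercive B) {V : Submodule ℝ H}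
    (hV : IsClosed (V : Set H)) (w : H) : ∃ v ∈ V, ∀ u ∈ V, B (w - v) u = 0 := by
  have : CompleteSpace V := hV.completeSpace_coe
  let b : V →L[ℝ] V →L[ℝ] ℝ := B.bilinearComp V.subtypeL V.subtypeL
  have hb : IsCoercive b := by
    obtain ⟨C, hC, h⟩ := hB
    exact ⟨C, hC, fun v => h v⟩
  let f := (InnerProductSpace.toDual ℝ V).symm ((B w).comp V.subtypeL)
  refine ⟨hb.continuousLinearEquivOfBilin.symm f, Subtype.coe_prop _, fun v hv => ?_⟩
  have h1 := hb.continuousLinearEquivOfBilin_apply (hb.continuousLinearEquivOfBilin.symm f) ⟨v, hv⟩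
  rw [ContinuousLinearEquiv.apply_symm_apply, InnerProductSpace.toDual_symm_apply] at h1
  rw [map_sub, sub_apply, sub_eq_zero]
  exact h1

/-- From `c ‖v‖² ≤ B v v = B v (v - v₁)`. It replaces the unspecified `v₁` of the key assumption by
`0` when `v ∈ V^⊥`. -/
theorem exists_norm_le_mul_norm_sub {B : H →L[ℝ] H →L[ℝ] ℝ} (hB : IsCoercive B) :
    ∃ M : ℝ, 0 < M ∧ ∀ (v v₁ : H), B v v₁ = 0 → ‖v‖ ≤ M * ‖v - v₁‖ := by
  obtain ⟨c, hc, hcB⟩ := hB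
  -- The summand `1` keeps the constant positive on a trivial space, where `‖B‖ = 0`.
  refine ⟨c⁻¹ * (‖B‖ + 1), by positivity, fun v v₁ hv => ?_⟩
  rcases eq_or_ne v 0 with rfl | hv0
  · rw [norm_zero]; positivity
  have h1 : B v v = B v (v - v₁) := by rw [map_sub, hv, sub_zero]
  have h2 : B v (v - v₁) ≤ ‖B‖ * ‖v‖ * ‖v - v₁‖ :=
    (le_abs_self _).trans (B.le_opNorm₂ v (v - v₁))
  rw [mul_assoc, le_inv_mul_iff₀ hc]
  refine le_of_mul_le_mul_right ?_ (norm_pos_iff.2 hv0)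
  calc c * ‖v‖ * ‖v‖ ≤ B v v := hcB v
    _ ≤ ‖B‖ * ‖v‖ * ‖v - v₁‖ := h1 ▸ h2
    _ ≤ (‖B‖ + 1) * ‖v‖ * ‖v - v₁‖ := by gcongr; linarith
    _ = (‖B‖ + 1) * ‖v - v₁‖ * ‖v‖ := by ring

/-- The lower bound makes `⟪K v, K w⟫` coercive on `P`. A bounded operator is produced, rather than
one solution per `ψ`, so that regularity in a parameter passes to the solution. -/
theorem exists_solutionOp [CompleteSpace H] [CompleteSpace L] (K : H →L[ℝ] L) {P : Submodule ℝ H}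
    (hP : IsClosed (P : Set H)) {C : ℝ} (hC : 0 < C) (h : ∀ v ∈ P, ‖v‖ ≤ C * ‖K v‖) :
    ∃ R : L →L[ℝ] H, (∀ ψ, R ψ ∈ P) ∧ ∀ ψ, ∀ w ∈ P, ⟪ψ + K (R ψ), K w⟫ = 0 := by
  have : CompleteSpace P := hP.completeSpace_coe
  let K' : P →L[ℝ] L := K.comp P.subtypeL
  let b : P →L[ℝ] P →L[ℝ] ℝ := (innerSL ℝ).bilinearComp K' K'
  have hb : IsCoercive b := by
    refine ⟨(C * C)⁻¹, by positivity, fun v => ?_⟩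
    have h1 : ‖v‖ ≤ C * ‖K' v‖ := h v v.2
    have h2 : b v v = ‖K' v‖ * ‖K' v‖ := real_inner_self_eq_norm_mul_norm (K' v)
    rw [h2, mul_assoc, inv_mul_le_iff₀ (by positivity)]
    calc ‖v‖ * ‖v‖ ≤ (C * ‖K' v‖) * (C * ‖K' v‖) :=
          mul_le_mul h1 h1 (norm_nonneg _) (by positivity)
      _ = _ := by ring
  let Φ := hb.continuousLinearEquivOfBilin
  -- `Φ` represents `K'* K'`, so this solves the normal equations of minimising `‖ψ + K v‖` over `v
  -- ∈ P`.
  let R₀ : L →L[ℝ] P := -((Φ.symm : P →L[ℝ] P).comp (ContinuousLinearMap.adjoint K'))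
  refine ⟨P.subtypeL.comp R₀, fun ψ => (R₀ ψ).2, fun ψ w hw => ?_⟩
  have h1 : Φ (R₀ ψ) = -ContinuousLinearMap.adjoint K' ψ := by simp [R₀]
  have h2 : ⟪K' (R₀ ψ), K' ⟨w, hw⟩⟫ = -⟪ψ, K' ⟨w, hw⟩⟫ := by
    refine (hb.continuousLinearEquivOfBilin_apply (R₀ ψ) ⟨w, hw⟩).symm.trans ?_
    change ⟪Φ (R₀ ψ), _⟫ = _
    rw [h1, inner_neg_left, ContinuousLinearMap.adjoint_inner_left]
  rw [inner_add_left]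
  change ⟪ψ, K' ⟨w, hw⟩⟫ + ⟪K' (R₀ ψ), K' ⟨w, hw⟩⟫ = 0
  rw [h2, add_neg_cancel]

end Abstract

/-! ### The corrector operator -/

theorem exists_norm_le_sqrtGrad {n d : ℕ} {a : DegTensor n d} (ha : KeyAssumption a)
    {B : H1 n d →L[ℝ] H1 n d →L[ℝ] ℝ} (hB : IsEquivInner B) :
    ∃ C : ℝ, 0 < C ∧ ∀ v ∈ spaceVperp a B, ‖v‖ ≤ C * ‖a.sqrtGrad v‖ := by
  obtain ⟨C, hC, h⟩ := ha
  obtain ⟨M, hM, hMB⟩ := exists_norm_le_mul_norm_sub hB.coercive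
  refine ⟨M * (C * (‖a.sqrtOp‖ + 1)), by positivity, fun v hv => ?_⟩
  obtain ⟨v₁, hv₁, hle⟩ := h v
  have h4 : ‖a.op (gradY n d v)‖ ≤ (‖a.sqrtOp‖ + 1) * ‖a.sqrtGrad v‖ := by
    rw [← a.sqrtOp_sqrtOp]
    refine (a.sqrtOp.le_opNorm _).trans ?_
    exact mul_le_mul_of_nonneg_right (by linarith) (norm_nonneg _)
  calc ‖v‖ ≤ M * ‖v - v₁‖ := hMB v v₁ (hv v₁ hv₁)
    _ ≤ M * (C * ((‖a.sqrtOp‖ + 1) * ‖a.sqrtGrad v‖)) :=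
      mul_le_mul_of_nonneg_left (hle.trans (mul_le_mul_of_nonneg_left h4 hC.le)) hM.le
    _ = _ := by ring

/-- `ψ + a^{1/2} ∇_y v ∈ W` only if it is the projection of `ψ`. -/
theorem projW_eq_of_add_sqrtGrad_mem {n d : ℕ} {a : DegTensor n d} {ψ : TenL2 n d} {v : H1 n d}
    (h : ψ + a.sqrtGrad v ∈ spaceW a) : projW a ψ = ψ + a.sqrtGrad v := by
  -- The residual `-a.sqrtGrad v` is orthogonal to `W`.
  refine Submodule.eq_starProjection_of_mem_of_inner_eq_zero h fun χ hχ => ?_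
  rw [sub_add_cancel_left, inner_neg_left, real_inner_comm, neg_eq_zero]
  exact (mem_spaceW_iff a χ).1 hχ _

/-- There is a bounded operator `R` with values in `V^⊥` such that
`P_W ψ = ψ + a^{1/2} ∇_y (R ψ)`. -/
theorem exists_correctorOp {n d : ℕ} {a : DegTensor n d} (ha : KeyAssumption a)
    {B : H1 n d →L[ℝ] H1 n d →L[ℝ] ℝ} (hB : IsEquivInner B) :
    ∃ R : TenL2 n d →L[ℝ] H1 n d, (∀ ψ, R ψ ∈ spaceVperp a B) ∧
      ∀ ψ, projW a ψ = ψ + a.sqrtGrad (R ψ) := by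
  obtain ⟨C, hC, h⟩ := exists_norm_le_sqrtGrad ha hB
  obtain ⟨R, hR, hRK⟩ := exists_solutionOp a.sqrtGrad (spaceVperp_isClosed a B) hC h
  refine ⟨R, hR, fun ψ => projW_eq_of_add_sqrtGrad_mem ((mem_spaceW_iff a _).2 fun w => ?_)⟩
  -- The equation is known only against `V^⊥`; the `V`-component of `w` is invisible to
  -- `a.sqrtGrad`.
  obtain ⟨v, hv, hwv⟩ := exists_sub_perp hB.coercive (spaceV_isClosed a) w
  have h1 := hRK ψ (w - v) hwv
  rwa [map_sub, (mem_spaceV_iff a v).1 hv, sub_zero] at h1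

theorem sqrtGrad_injOn_spaceVperp {n d : ℕ} {a : DegTensor n d} {B : H1 n d →L[ℝ] H1 n d →L[ℝ] ℝ}
    (hB : IsEquivInner B) {v w : H1 n d} (hv : v ∈ spaceVperp a B) (hw : w ∈ spaceVperp a B)
    (h : a.sqrtGrad v = a.sqrtGrad w) : v = w := by
  refine sub_eq_zero.1 (eq_zero_of_mem_spaceV_of_mem_spaceVperp hB ?_ (sub_mem hv hw))
  rw [mem_spaceV_iff, map_sub, h, sub_self]

/-! ### Integration by parts and the operator `T` -/

section IntegrationByParts

variable {d : ℕ} {F : Type*} [NormedAddCommGroup F] [InnerProductSpace ℝ F]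

/-- `g` is uncontrolled near the boundary of `Ω`, but the integrand lives on a compact subset.
Keeping `k` apart from `f` lets `f` be a derivative of `k`. -/
theorem integrable_inner_of_continuousOn {Ω : Set (Pt d)} {f k g : Pt d → F}
    (hk : HasCompactSupport k) (hkΩ : tsupport k ⊆ Ω) (hf : Continuous f)
    (hfk : ∀ x ∉ tsupport k, f x = 0) (hg : ContinuousOn g Ω) :
    Integrable (fun x => ⟪f x, g x⟫) := by
  have h1 : IntegrableOn (fun x => ⟪f x, g x⟫) (tsupport k) :=
    (hf.continuousOn.inner (hg.mono hkΩ)).integrableOn_compact hk.isCompact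
  refine (integrableOn_iff_integrable_of_support_subset ?_).1 h1
  intro x hx
  by_contra h
  exact hx (by simp only [hfk x h, inner_zero_left])

theorem setIntegral_inner_fderiv_eq_neg {Ω : Set (Pt d)} (hΩ : IsOpen Ω) {f g : Pt d → F}
    (hf : ContDiff ℝ ∞ f) (hfc : HasCompactSupport f) (hfΩ : tsupport f ⊆ Ω)
    (hg : ContDiffOn ℝ ∞ g Ω) (v : Pt d) :
    Integrable (fun x => ⟪f x, fderiv ℝ g x v⟫) ∧
    Integrable (fun x => ⟪fderiv ℝ f x v, g x⟫) ∧
    ∫ x in Ω, ⟪f x, fderiv ℝ g x v⟫ = - ∫ x in Ω, ⟪fderiv ℝ f x v, g x⟫ := by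
  have hz : ∀ x ∉ tsupport f, f x = 0 := fun x hx => image_eq_zero_of_notMem_tsupport hx
  have hz' : ∀ x ∉ tsupport f, fderiv ℝ f x v = 0 := fun x hx => by
    rw [fderiv_of_notMem_tsupport ℝ hx, zero_apply]
  have hcf : Continuous fun x => fderiv ℝ f x v :=
    (hf.continuous_fderiv (by simp)).clm_apply continuous_const
  have hcg : ContinuousOn (fun x => fderiv ℝ g x v) Ω :=
    (hg.continuousOn_fderiv_of_isOpen hΩ (by simp)).clm_apply continuousOn_const
  have i1 := integrable_inner_of_continuousOn hfc hfΩ hf.continuous hz hcg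
  have i2 := integrable_inner_of_continuousOn hfc hfΩ hcf hz' hg.continuousOn
  have i3 := integrable_inner_of_continuousOn hfc hfΩ hf.continuous hz hg.continuousOn
  refine ⟨i1, i2, ?_⟩
  -- Both integrands vanish off `Ω`, so the integrals extend to the whole space and no boundary term
  -- appears.
  rw [setIntegral_eq_integral_of_forall_compl_eq_zero fun x hx => by
      rw [hz x fun h => hx (hfΩ h), inner_zero_left],
    setIntegral_eq_integral_of_forall_compl_eq_zero fun x hx => by
      rw [hz' x fun h => hx (hfΩ h), inner_zero_left]]
  refine integral_bilinear_fderiv_right_eq_neg_left_of_integrable (B := innerSL ℝ) i2 i1 i3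
    (fun x _ => hf.differentiable (by simp) x) fun x hx => ?_
  exact (hg.differentiableOn (by simp)).differentiableAt (hΩ.mem_nhds (hfΩ hx))

theorem integrable_inner_of_memLp {μ : Measure (Pt d)} {f g : Pt d → F} (hf : MemLp f 2 μ)
    (hg : MemLp g 2 μ) : Integrable (fun x => ⟪f x, g x⟫) μ := by
  refine (hf.norm.integrable_mul hg.norm).mono
    (hf.aestronglyMeasurable.inner hg.aestronglyMeasurable) (Eventually.of_forall fun x => ?_)
  simpa using norm_inner_le_norm (𝕜 := ℝ) (f x) (g x)

/-- A square integrable field with values in a closed subspace `W` vanishes if it is orthogonal to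
all fields `χ(x) w`. -/
theorem ae_eq_zero_of_integral_inner_smul_eq_zero [CompleteSpace F] {Ω : Set (Pt d)}
    (hΩ : IsOpen Ω) {W : Submodule ℝ F} [W.HasOrthogonalProjection] {η : Pt d → F}
    (hη : MemLp η 2 (volume.restrict Ω)) (hW : ∀ᵐ x ∂(volume.restrict Ω), η x ∈ W)
    (h : ∀ χ : Pt d → ℝ, ContDiff ℝ ∞ χ → HasCompactSupport χ → tsupport χ ⊆ Ω → ∀ w ∈ W,
      ∫ x in Ω, ⟪η x, χ x • w⟫ = 0) :
    ∀ᵐ x ∂(volume.restrict Ω), η x = 0 := by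
  have hloc : LocallyIntegrable η (volume.restrict Ω) := hη.locallyIntegrable (by norm_num)
  have hmain := hΩ.ae_eq_zero_of_integral_contDiff_smul_eq_zero (μ := volume.restrict Ω)
    (hloc.locallyIntegrableOn Ω) ?_
  · filter_upwards [hmain, ae_restrict_mem hΩ.measurableSet] with x h1 h2 using h1 h2
  intro χ hχ hχc hχΩ
  have hint : Integrable (fun x => χ x • η x) (volume.restrict Ω) :=
    hloc.integrable_smul_left_of_hasCompactSupport hχ.continuous hχc
  obtain ⟨z, hz⟩ : ∃ z, z = ∫ x in Ω, χ x • η x := ⟨_, rfl⟩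
  -- The projector on `W` commutes with the integral, so `z` stays in `W` and is itself an
  -- admissible `w`; testing with it gives `‖z‖² = 0`.
  have hzW : z ∈ W := by
    rw [← Submodule.starProjection_eq_self_iff, hz, ← ContinuousLinearMap.integral_comp_comm _ hint]
    refine integral_congr_ae ?_
    filter_upwards [hW] with x hx
    rw [map_smul, Submodule.starProjection_eq_self_iff.2 hx]
  have h1 : ⟪z, z⟫ = 0 :=
    calc ⟪z, z⟫ = ⟪z, ∫ x in Ω, χ x • η x⟫ := by rw [← hz]
      _ = ∫ x in Ω, ⟪z, χ x • η x⟫ := (integral_inner hint z).symm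
      _ = ∫ x in Ω, ⟪η x, χ x • z⟫ := by
        simp only [real_inner_smul_right, real_inner_comm]
      _ = 0 := h χ hχ hχc hχΩ z hzW
  rw [← hz]
  exact inner_self_eq_zero.1 h1

end IntegrationByParts

section Test

variable {d : ℕ} {X Y : Type*} [NormedAddCommGroup X] [NormedSpace ℝ X] [NormedAddCommGroup Y]
  [NormedSpace ℝ Y]

theorem hasCompactSupport_clm_comp (A : X →L[ℝ] Y) {f : Pt d → X} (hf : HasCompactSupport f) :
    HasCompactSupport fun x => A (f x) :=
  hf.comp_left (map_zero A)

theorem tsupport_clm_comp_subset (A : X →L[ℝ] Y) (f : Pt d → X) :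
    tsupport (fun x => A (f x)) ⊆ tsupport f :=
  closure_mono fun x hx h => hx (by simp only [h, map_zero])

end Test

/-- `(∇_x φ)(x, ·)` as a bounded linear function of the derivative of `φ` at `x`. -/
theorem exists_gradX_eq (n d : ℕ) : ∃ A : (Pt d →L[ℝ] H1 n d) →L[ℝ] TenL2 n d,
    ∀ φ : Pt d → H1 n d, gradX φ = fun x => A (fderiv ℝ φ x) := by
  refine ⟨∑ j, ((toColumn n j).compLpL 2 (cellMeasure d)).comp ((incl n d).comp
    (ContinuousLinearMap.apply ℝ (H1 n d) (basisVec j))), fun φ => ?_⟩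
  funext x
  simp only [gradX, sum_apply]
  rfl

section GradX

variable {n d : ℕ} {Ω : Set (Pt d)} {S : Submodule ℝ (H1 n d)} {φ : Pt d → H1 n d}

theorem IsTest.contDiff_gradX (h : IsTest Ω S φ) : ContDiff ℝ ∞ (gradX φ) := by
  obtain ⟨A, hA⟩ := exists_gradX_eq n d
  rw [hA φ]
  exact A.contDiff.comp (contDiff_infty_iff_fderiv.1 h.smooth).2

theorem tsupport_gradX_subset (φ : Pt d → H1 n d) : tsupport (gradX φ) ⊆ tsupport φ := by
  obtain ⟨A, hA⟩ := exists_gradX_eq n d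
  rw [hA φ]
  exact (tsupport_clm_comp_subset A (fderiv ℝ φ)).trans (tsupport_fderiv_subset ℝ (f := φ))

theorem IsTest.hasCompactSupport_gradX (h : IsTest Ω S φ) : HasCompactSupport (gradX φ) :=
  h.hasCompactSupport.of_isClosed_subset (isClosed_tsupport _) (tsupport_gradX_subset φ)

/-- Integration by parts against a smooth tensor field. -/
theorem IsTest.integral_inner_divX (hΩ : IsOpen Ω) (h : IsTest Ω S φ) {g : Pt d → TenL2 n d}
    (hg : ContDiffOn ℝ ∞ g Ω) :
    ∫ x in Ω, ⟪incl n d (φ x), divX g x⟫ = - ∫ x in Ω, ⟪gradX φ x, g x⟫ := by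
  -- With `A j` filling column `j`, both pairings become sums over `j`, and integration by parts
  -- applies in each coordinate separately.
  let A : Fin d → H1 n d →L[ℝ] TenL2 n d := fun j =>
    ((toColumn n j).compLpL 2 (cellMeasure d)).comp (incl n d)
  have hA : ∀ j x, fderiv ℝ (fun x => A j (φ x)) x (basisVec j) =
      A j (fderiv ℝ φ x (basisVec j)) := fun j x => by
    have h1 := ((A j).hasFDerivAt.comp x (h.smooth.differentiable (by simp) x).hasFDerivAt).fderiv
    change fderiv ℝ (A j ∘ φ) x _ = _
    rw [h1]
    rfl
  have key := fun j => setIntegral_inner_fderiv_eq_neg hΩ (f := fun x => A j (φ x)) ((A j).contDiff.comp h.smooth)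
    (hasCompactSupport_clm_comp (A j) h.hasCompactSupport)
    ((tsupport_clm_comp_subset (A j) φ).trans h.support_subset) hg (basisVec j)
  have e1 : ∀ x, ⟪incl n d (φ x), divX g x⟫ =
      ∑ j, ⟪A j (φ x), fderiv ℝ g x (basisVec j)⟫ := fun x => by
    rw [divX, inner_sum]
    exact Finset.sum_congr rfl fun j _ => (inner_toColumn_compLp j _ _).symm
  have e2 : ∀ x, ⟪gradX φ x, g x⟫ =
      ∑ j, ⟪fderiv ℝ (fun x => A j (φ x)) x (basisVec j), g x⟫ := fun x => by
    rw [gradX, sum_inner]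
    exact Finset.sum_congr rfl fun j _ => by rw [hA]; rfl
  simp only [e1, e2]
  rw [integral_finsetSum _ fun j _ => (key j).1.integrableOn,
    integral_finsetSum _ fun j _ => (key j).2.1.integrableOn, ← Finset.sum_neg_distrib]
  exact Finset.sum_congr rfl fun j _ => (key j).2.2

end GradX

/-! ### Characterisation of `T` on test functions and uniqueness of the corrector -/

theorem IsTest.isT_iff {n d : ℕ} {Ω : Set (Pt d)} (hΩ : IsOpen Ω) (a : DegTensor n d)
    {φ : Pt d → H1 n d} (h : IsTest Ω (spaceV a) φ) (ξ : Pt d → TenL2 n d) :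
    IsT a Ω φ ξ ↔ ∀ᵐ x ∂(volume.restrict Ω), ξ x = projW a (a.sqrtOp (gradX φ x)) := by
  let ξ₀ : Pt d → TenL2 n d := fun x => projW a (a.sqrtOp (gradX φ x))
  have hcont : Continuous ξ₀ :=
    (projW a).continuous.comp (a.sqrtOp.continuous.comp h.contDiff_gradX.continuous)
  have hsupp : HasCompactSupport ξ₀ :=
    hasCompactSupport_clm_comp ((projW a).comp a.sqrtOp) h.hasCompactSupport_gradX
  have hmem : MemLp ξ₀ 2 (volume.restrict Ω) :=
    (hcont.memLp_of_hasCompactSupport hsupp).restrict Ω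
  have hproj : ∀ ψ, projW a ψ ∈ spaceW a := fun ψ => Submodule.starProjection_apply_mem _ _
  -- Existence and uniqueness both rest on this identity. Compact support of `φ` in `Ω` makes the
  -- boundary behaviour of `Ψ` immaterial.
  have hid : ∀ Ψ : Pt d → TenL2 n d, ContDiffOn ℝ ∞ Ψ Ω → (∀ x ∈ Ω, Ψ x ∈ spaceW a) →
      ∫ x in Ω, ⟪ξ₀ x, Ψ x⟫ =
        - ∫ x in Ω, ⟪incl n d (φ x), divX (fun x' => a.sqrtOp (Ψ x')) x⟫ := by
    intro Ψ hΨ hΨW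
    rw [h.integral_inner_divX hΩ (g := fun x => a.sqrtOp (Ψ x))
      (a.sqrtOp.contDiff.comp_contDiffOn hΨ), neg_neg]
    refine setIntegral_congr_fun hΩ.measurableSet fun x hx => ?_
    have h1 : projW a (Ψ x) = Ψ x := Submodule.starProjection_eq_self_iff.2 (hΨW x hx)
    have h2 : ⟪ξ₀ x, Ψ x⟫ = ⟪a.sqrtOp (gradX φ x), projW a (Ψ x)⟫ :=
      Submodule.inner_starProjection_left_eq_right _ _ _
    exact h2.trans (by rw [h1, a.inner_sqrtOp_left])
  constructor
  · intro hT
    -- `ξ - ξ₀` is `W`-valued, and subtracting the two identities for `Ψ = χ w` makes it orthogonal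
    -- to all such fields.
    have hzero := ae_eq_zero_of_integral_inner_smul_eq_zero hΩ (W := spaceW a)
      (hT.memLp_flux.sub hmem) ?_ ?_
    · filter_upwards [hzero] with x hx using sub_eq_zero.1 hx
    · filter_upwards [hT.flux_mem] with x hx using sub_mem hx (hproj _)
    · intro χ hχ hχc hχΩ w hw
      have hΨ : ContDiff ℝ ∞ fun x => χ x • w := hχ.smul contDiff_const
      have hΨc : HasCompactSupport fun x => χ x • w := hχc.smul_right
      have hΨW : ∀ x ∈ Ω, χ x • w ∈ spaceW a := fun x _ => Submodule.smul_mem _ _ hw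
      have m1 : MemLp (fun x => χ x • w) 2 (volume.restrict Ω) :=
        (hΨ.continuous.memLp_of_hasCompactSupport hΨc).restrict Ω
      have m2 : MemLp (fderiv ℝ fun x => χ x • w) 2 (volume.restrict Ω) :=
        ((hΨ.continuous_fderiv (by simp)).memLp_of_hasCompactSupport (hΨc.fderiv ℝ)).restrict Ω
      have e1 := hT.identity _ hΨ.contDiffOn hΨW m1 m2
      have e2 := hid _ hΨ.contDiffOn hΨW
      simp only [Pi.sub_apply, inner_sub_left]
      rw [integral_sub (integrable_inner_of_memLp hT.memLp_flux m1) (integrable_inner_of_memLp hmem m1), e1, e2,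
        sub_self]
  · intro hξ
    refine ⟨?_, Eventually.of_forall h.mem, (memLp_congr_ae hξ).2 hmem, ?_, ?_⟩
    · exact (h.smooth.continuous.memLp_of_hasCompactSupport h.hasCompactSupport).restrict Ω
    · filter_upwards [hξ] with x hx
      rw [hx]
      exact hproj _
    · intro Ψ hΨ hΨW _ _
      rw [← hid Ψ hΨ hΨW]
      refine integral_congr_ae ?_
      filter_upwards [hξ] with x hx
      rw [hx]

/-- On `Ω` the fluxes agree and `a.sqrtGrad` is injective on `V^⊥`; outside `Ω` both functions
vanish by their supports. -/
theorem IsCorrector.eq {n d : ℕ} {a : DegTensor n d} {B : H1 n d →L[ℝ] H1 n d →L[ℝ] ℝ}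
    (hB : IsEquivInner B) {Ω : Set (Pt d)} {φ₀ φ₁ φ₁' : Pt d → H1 n d}
    (h : IsCorrector a B Ω φ₀ φ₁) (h' : IsCorrector a B Ω φ₀ φ₁') : φ₁' = φ₁ := by
  funext x
  by_cases hx : x ∈ Ω
  · refine sqrtGrad_injOn_spaceVperp hB (h'.test.mem x) (h.test.mem x) ?_
    have := (h'.flux_eq x hx).symm.trans (h.flux_eq x hx)
    rw [map_add, map_add] at this
    exact add_left_cancel this
  · rw [image_eq_zero_of_notMem_tsupport fun hs => hx (h'.test.support_subset hs),
      image_eq_zero_of_notMem_tsupport fun hs => hx (h.test.support_subset hs)]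

end TwoScale

theorem mainTheorem5 {n d : ℕ} (hn : 1 ≤ n) (hd : 2 ≤ d)
    (Ω : Set (TwoScale.Pt d)) (hΩ : IsOpen Ω)
    (a : TwoScale.DegTensor n d) (ha : TwoScale.KeyAssumption a)
    (B : TwoScale.H1 n d →L[ℝ] TwoScale.H1 n d →L[ℝ] ℝ) (hB : TwoScale.IsEquivInner B)
    (φ₀ : TwoScale.Pt d → TwoScale.H1 n d) (hφ₀ : TwoScale.IsTest Ω (TwoScale.spaceV a) φ₀) :
    (∀ ξ : TwoScale.Pt d → TwoScale.TenL2 n d, TwoScale.IsT a Ω φ₀ ξ ↔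
      ∀ᵐ x ∂(volume.restrict Ω),
        ξ x = TwoScale.projW a (a.sqrtOp (TwoScale.gradX φ₀ x))) ∧
    ∃ φ₁ : TwoScale.Pt d → TwoScale.H1 n d,
      TwoScale.IsCorrector a B Ω φ₀ φ₁ ∧
      (∀ φ₁', TwoScale.IsCorrector a B Ω φ₀ φ₁' → φ₁' = φ₁) ∧
      ∀ x ∈ Ω, ∀ v ∈ TwoScale.spaceVperp a B,
        TwoScale.DivFree (a.op (TwoScale.gradX φ₀ x + TwoScale.gradY n d v)) ↔ v = φ₁ x := by
  refine ⟨hφ₀.isT_iff hΩ a, ?_⟩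
  obtain ⟨R, hR, hRW⟩ := TwoScale.exists_correctorOp ha hB
  let A : TwoScale.TenL2 n d →L[ℝ] TwoScale.H1 n d := R.comp a.sqrtOp
  have hφ₁ : TwoScale.IsCorrector a B Ω φ₀ fun x => A (TwoScale.gradX φ₀ x) := by
    refine ⟨⟨A.contDiff.comp hφ₀.contDiff_gradX,
      TwoScale.hasCompactSupport_clm_comp A hφ₀.hasCompactSupport_gradX,
      (TwoScale.tsupport_clm_comp_subset A _).trans
        ((TwoScale.tsupport_gradX_subset φ₀).trans hφ₀.support_subset), fun x => hR _⟩,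
      fun x _ => ?_⟩
    rw [hRW, map_add]
    rfl
  refine ⟨_, hφ₁, fun φ₁' h => hφ₁.eq hB h, fun x hx v hv => ?_⟩
  rw [TwoScale.divFree_op_iff]
  have hW := hRW (a.sqrtOp (TwoScale.gradX φ₀ x))
  constructor
  · intro h
    -- A solution of the cell problem has its flux in `W`, so this flux is the projection, just as
    -- for `R`.
    refine TwoScale.sqrtGrad_injOn_spaceVperp hB hv (hR _) ?_
    exact add_left_cancel ((TwoScale.projW_eq_of_add_sqrtGrad_mem h).symm.trans hW)
  · rintro rfl
    exact hW ▸ Submodule.starProjection_apply_mem (TwoScale.spaceW a) _
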